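/- Let $G=\widetilde{\mathrm{SL}(2,\mathbb R)}$ be the universal covering group of $\mathrm{SL}(2,\mathbb R)$, and let $(F_1,F_2,F_3)$ be a frame of left-invariant vector fields on $G$ with $$[F_2,F_3]=-2F_1,\qquad [F_3,F_1]=2F_2,\qquad [F_1,F_2]=2F_3,$$ with dual coframe $(\omega^1,\omega^2,\omega^3)$. Let $g_0=A_0\,\omega^1\otimes\omega^1+B_0\,\omega^2\otimes\omega^2+C_0\,\omega^3\otimes\omega^3$ be a left-invariant Riemannian metric with $A_0>0$ and $B_0=C_0>0$, and put $h=\omega^1\otimes\omega^1+\omega^2\otimes\omega^2+\omega^3\otimes\omega^3$. For a Riemannian metric $g$ on $G$, with Levi-Civita connection $\nabla$, Ricci tensor $R_{ij}$, scalar curvature $R$ and volume measure $\mu_g$, the Cotton–York tensor is $$C_2=C_{ij}=g_{ik}\,\varepsilon^{klm}\Bigl(\nabla_lR_{mj}-\tfrac14\nabla_lR\,g_{mj}\Bigr),\qquad \varepsilon^{klm}=\frac{\eta^{klm}}{\sqrt{\det g}},$$ where $\eta^{klm}$ is the completely antisymmetric symbol with $\eta^{123}=1$; its norm is $|C_2|_g=(g^{ip}g^{jq}C_{ij}C_{pq})^{1/2}$,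 and for compact $K\subset G$ put $C_K(g)=\int_K|C_2|_g\,d\mu_g$. Then a solution $g(t)$, $0\le t<\infty$, of the Ricci flow $\partial_t g=-2\,\mathrm{Ric}_g$ through left-invariant metrics with $g(0)=g_0$ exists, and every such solution has the following properties. There are functions $A,B>0$ on $[0,\infty)$ with $$g(t)=A(t)\,\omega^1\otimes\omega^1+B(t)\,(\omega^2\otimes\omega^2+\omega^3\otimes\omega^3),\qquad t\ge 0,$$ and for every compact set $K\subset G$ $$C_K(g(t))=4\sqrt6\,\frac{A(t)}{B(t)}\Bigl(1+\frac{A(t)}{B(t)}\Bigr)\mathrm{Vol}(K,h),\qquad t\ge0.$$ Moreover $C_K(g(t))\to0$ as $t\to\infty$, and if $\mathrm{Vol}(K,h)>0$, then $t\mapsto C_K(g(t))$ is strictly decreasing on $[0,\infty)$. -/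

import Mathlib

open scoped Manifold ContDiff Topology
open MeasureTheory Bundle

noncomputable section

namespace CottonYork

/-- The model space of three-dimensional manifolds. -/
abbrev E3 : Type := EuclideanSpace ℝ (Fin 3)

/-! ### Three-dimensional Riemannian geometry -/

section Manifold

variable {M : Type*} [TopologicalSpace M] [ChartedSpace E3 M]

/-- A smooth Riemannian metric on a smooth three-dimensional manifold. -/
abbrev Metric (M : Type*) [TopologicalSpace M] [ChartedSpace E3 M] [IsManifold (𝓡 3) ∞ M] :
    Type _ :=
  ContMDiffRiemannianMetric (𝓡 3) ∞ E3 (fun x : M => TangentSpace (𝓡 3) x)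

/-- A (not necessarily smooth) vector field on `M`. -/
abbrev VField (M : Type*) [TopologicalSpace M] [ChartedSpace E3 M] : Type _ :=
  (x : M) → TangentSpace (𝓡 3) x

/-- The derivative `X f` of a function `f` along a vector field `X`. -/
def dirDeriv (X : VField M) (f : M → ℝ) (x : M) : ℝ :=
  mfderiv (𝓡 3) 𝓘(ℝ, ℝ) f x (X x)

/-- The Lie bracket `[X, Y]` of two vector fields. -/
def bracket (X Y : VField M) : VField M :=
  VectorField.mlieBracket (𝓡 3) X Y

variable [IsManifold (𝓡 3) ∞ M]

/-- The function `g(X, Y)`. -/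
def pair (g : Metric M) (X Y : VField M) (x : M) : ℝ :=
  g.inner x (X x) (Y x)

/-- The Koszul formula for the Levi-Civita connection of `g`: this is `g(∇_X Y, Z)`. -/
def koszul (g : Metric M) (X Y Z : VField M) (x : M) : ℝ :=
  (1 / 2) * (dirDeriv X (pair g Y Z) x + dirDeriv Y (pair g X Z) x - dirDeriv Z (pair g X Y) x
    + pair g (bracket X Y) Z x - pair g (bracket X Z) Y x - pair g (bracket Y Z) X x)

/-! Below, `F` is a frame: three vector fields that form a basis of each tangent space. All tensors
are given by their components with respect to `F`. -/

/-- The components `g_{ij} = g(F_i, F_j)` of the metric. -/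
def gram (g : Metric M) (F : Fin 3 → VField M) (x : M) : Matrix (Fin 3) (Fin 3) ℝ :=
  Matrix.of fun i j => pair g (F i) (F j) x

/-- The components `g^{ij}` of the inverse metric. -/
def gramInv (g : Metric M) (F : Fin 3 → VField M) (x : M) : Matrix (Fin 3) (Fin 3) ℝ :=
  (gram g F x)⁻¹

/-- The structure functions of the frame: `[F_i, F_j] = ∑ k, c_{ij}^k F_k`. -/
def structFun (g : Metric M) (F : Fin 3 → VField M) (i j k : Fin 3) (x : M) : ℝ :=
  ∑ l, pair g (bracket (F i) (F j)) (F l) x * gramInv g F x l k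

/-- The coefficients of the Levi-Civita connection: `∇_{F_i} F_j = ∑ k, Γ_{ij}^k F_k`. -/
def christoffel (g : Metric M) (F : Fin 3 → VField M) (i j k : Fin 3) (x : M) : ℝ :=
  ∑ l, koszul g (F i) (F j) (F l) x * gramInv g F x l k

/-- The components of the curvature tensor: `R(F_i, F_j) F_k = ∑ m, R_{ijk}^m F_m`, where
`R(X, Y) Z = ∇_X ∇_Y Z - ∇_Y ∇_X Z - ∇_{[X, Y]} Z`. -/
def riem (g : Metric M) (F : Fin 3 → VField M) (i j k m : Fin 3) (x : M) : ℝ :=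
  dirDeriv (F i) (christoffel g F j k m) x - dirDeriv (F j) (christoffel g F i k m) x
    + ∑ p, christoffel g F j k p x * christoffel g F i p m x
    - ∑ p, christoffel g F i k p x * christoffel g F j p m x
    - ∑ p, structFun g F i j p x * christoffel g F p k m x

/-- The components `R_{jk}` of the Ricci tensor, `Ric(Y, Z) = tr (X ↦ R(X, Y) Z)`. -/
def ricci (g : Metric M) (F : Fin 3 → VField M) (j k : Fin 3) (x : M) : ℝ :=
  ∑ i, riem g F i j k i x

/-- The scalar curvature `R = g^{jk} R_{jk}`. -/
def scalarCurv (g : Metric M) (F : Fin 3 → VField M) (x : M) : ℝ :=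
  ∑ j, ∑ k, gramInv g F x j k * ricci g F j k x

/-- The components `∇_l R_{mj}` of the covariant derivative of the Ricci tensor. -/
def covRicci (g : Metric M) (F : Fin 3 → VField M) (l m j : Fin 3) (x : M) : ℝ :=
  dirDeriv (F l) (ricci g F m j) x
    - ∑ p, christoffel g F l m p x * ricci g F p j x
    - ∑ p, christoffel g F l j p x * ricci g F m p x

/-- The completely antisymmetric symbol `η^{klm}` with `η^{123} = 1`: the sign of `(k, l, m)` as a
permutation of the three indices, and zero if two of them agree. -/
def eta (k l m : Fin 3) : ℝ :=
  ((1 : Matrix (Fin 3) (Fin 3) ℝ).submatrix ![k, l, m] id).det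

/-- The components of the Cotton-York tensor,
`C_{ij} = g_{ik} ε^{klm} (∇_l R_{mj} - (1/4) (∇_l R) g_{mj})` with `ε^{klm} = η^{klm} / √(det g)`. -/
def cottonYork (g : Metric M) (F : Fin 3 → VField M) (i j : Fin 3) (x : M) : ℝ :=
  ∑ k, ∑ l, ∑ m, gram g F x i k * (eta k l m / √(gram g F x).det) *
    (covRicci g F l m j x - (1 / 4) * dirDeriv (F l) (scalarCurv g F) x * gram g F x m j)

/-- The norm `|C_2|_g = (g^{ip} g^{jq} C_{ij} C_{pq})^{1/2}` of the Cotton-York tensor. -/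
def cottonYorkNorm (g : Metric M) (F : Fin 3 → VField M) (x : M) : ℝ :=
  √(∑ i, ∑ j, ∑ p, ∑ q, gramInv g F x i p * gramInv g F x j q *
    cottonYork g F i j x * cottonYork g F p q x)

/-! ### The Riemannian volume measure -/

/-- The coordinate vector field `∂/∂x^i` of the chart `e`, at the point with coordinates `y`. -/
def coordVec (e : OpenPartialHomeomorph M E3) (i : Fin 3) (y : E3) :
    TangentSpace (𝓡 3) (e.symm y) :=
  mfderiv (𝓡 3) (𝓡 3) e.symm y (EuclideanSpace.single i (1 : ℝ) : E3)

/-- The volume density `√(det g_{ij})` of `g` in the chart `e`. -/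
def volDensity (g : Metric M) (e : OpenPartialHomeomorph M E3) (y : E3) : ℝ :=
  √(Matrix.det (Matrix.of fun i j : Fin 3 =>
    g.inner (e.symm y) (coordVec e i y) (coordVec e j y)))

variable [MeasurableSpace M]

/-- The measure `√(det g_{ij}) dx^1 dx^2 dx^3` of the chart `e`, as a measure on `M` that lives on
the domain of `e`. -/
def chartVolume (g : Metric M) (e : OpenPartialHomeomorph M E3) : Measure M :=
  (((volume : Measure E3).restrict e.target).withDensity
    fun y => ENNReal.ofReal (volDensity g e y)).map e.symm

/-- The Riemannian volume measure: the measure on `M` that restricts to `chartVolume g e` on the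
domain of each chart `e`. Since the measures of the charts agree on overlaps, it is their supremum
in the lattice of measures. -/
def riemVolume (g : Metric M) : Measure M :=
  ⨆ x : M, chartVolume g (chartAt E3 x)

/-- The `L¹`-norm `∫_K |C_2|_g dμ_g` of the Cotton-York tensor on `K`. -/
def cottonYorkL1 (g : Metric M) (F : Fin 3 → VField M) (K : Set M) : ℝ :=
  ∫ x in K, cottonYorkNorm g F x ∂(riemVolume g)

end Manifold

/-! ### Left-invariant geometry on three-dimensional Lie groups -/

section LieGroup

variable {G : Type*} [TopologicalSpace G] [ChartedSpace E3 G] [Group G]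

/-- The left-invariant frame field with the values `e i` at the identity. -/
def frame (e : Module.Basis (Fin 3) ℝ (GroupLieAlgebra (𝓡 3) G)) : Fin 3 → VField G :=
  fun i => mulInvariantVectorField (e i)

/-- The bracket relations of a Milnor frame `(F_1, F_2, F_3)`:
`[F_2, F_3] = 2 λ F_1`, `[F_3, F_1] = 2 μ F_2`, `[F_1, F_2] = 2 ν F_3`. -/
structure MilnorRelations (e : Module.Basis (Fin 3) ℝ (GroupLieAlgebra (𝓡 3) G))
    (lam mu nu : ℝ) : Prop where
  rel1 : ⁅e 1, e 2⁆ = (2 * lam) • e 0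
  rel2 : ⁅e 2, e 0⁆ = (2 * mu) • e 1
  rel3 : ⁅e 0, e 1⁆ = (2 * nu) • e 2

/-- `p` exhibits the topological group `G` as the universal covering group of `SL(2, ℝ)`. -/
structure IsUniversalCoverSL2 (p : G →* Matrix.SpecialLinearGroup (Fin 2) ℝ) : Prop where
  simplyConnected : SimplyConnectedSpace G
  isCoveringMap : IsCoveringMap p
  surjective : Function.Surjective p

variable [LieGroup (𝓡 3) ∞ G]

/-- Left translations are isometries of `g`. -/
def IsLeftInvariant (g : Metric G) : Prop :=
  ∀ (a x : G) (v w : TangentSpace (𝓡 3) x),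
    g.inner (a * x) (mfderiv (𝓡 3) (𝓡 3) (fun y : G => a * y) x v)
      (mfderiv (𝓡 3) (𝓡 3) (fun y : G => a * y) x w) = g.inner x v w

/-- `g = A ω^1 ⊗ ω^1 + B ω^2 ⊗ ω^2 + C ω^3 ⊗ ω^3`, where the `ω^i` are the left-invariant one-forms
dual to the frame of `e`. -/
def IsLeftInvariantDiagonal (g : Metric G)
    (e : Module.Basis (Fin 3) ℝ (GroupLieAlgebra (𝓡 3) G)) (A B C : ℝ) : Prop :=
  IsLeftInvariant g ∧
    ∀ (x : G), gram g (frame e) x = Matrix.diagonal ![A, B, C]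

/-- `g(t)`, `0 ≤ t < ∞`, is a solution of the Ricci flow `∂g/∂t = -2 Ric` (one-sided derivative at
`t = 0`) through left-invariant metrics. The values `g t` with `t < 0` play no role. -/
structure IsLeftInvariantRicciFlow (g : ℝ → Metric G)
    (e : Module.Basis (Fin 3) ℝ (GroupLieAlgebra (𝓡 3) G)) : Prop where
  leftInvariant : ∀ t, 0 ≤ t → IsLeftInvariant (g t)
  ricciFlow : ∀ t, 0 ≤ t → ∀ (x : G) (i j : Fin 3),
    HasDerivWithinAt (fun s => gram (g s) (frame e) x i j)
      (-2 * ricci (g t) (frame e) i j x) (Set.Ici 0) t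

end LieGroup

end CottonYork

end

/-! In a left-invariant frame every tensor of a left-invariant metric has constant components, so
curvature becomes algebra in the structure constants and the Gram matrix. For `diag(A, B, B)` the
Ricci tensor is again of this shape (`ricciAlg_diagonal`), and the flow reduces to `A' = -4A²/B²`,
`B' = 8 + 4A/B`. The quantity `A²B/(A + B)` is conserved, which leads to a global solution in
hyperbolic functions (`exists_solution`).

A left-invariant flow need not be diagonal a priori. Its Gram matrix at the identity solves an
autonomous ODE with `C^1` right-hand side on invertible matrices, and uniqueness
(`eq_of_hasDerivWithinAt_Ici`) identifies it with the explicit solution.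

The Cotton-York tensor is a multiple of `diag(2A, -B, -B)`. Its norm times the volume factor
`√(AB²)` depends only on `A/B` (`cottonYorkNorm_diagonal`), so the integral over `K` is a function
of `A/B` times `Vol(K, h)`. Since `A` decreases and `B - 8t` does not, `A/B` decreases strictly to
`0`. Strictness of the integral also needs `Vol(K, h) < ∞`, that is, local finiteness of the volume
measure. -/

noncomputable section

namespace CottonYork

/-! ### Curvature of a metric with constant components in a frame with constant structure functions -/

section Algebraic

/-- The algebraic Koszul formula for structure constants `c` and constant components `P`. -/
def koszulAlg (c : Fin 3 → Fin 3 → Fin 3 → ℝ) (P : Matrix (Fin 3) (Fin 3) ℝ) (i j l : Fin 3) : ℝ :=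
  (1 / 2) * (∑ k, c i j k * P k l - ∑ k, c i l k * P k j - ∑ k, c j l k * P k i)

/-- The connection coefficients attached to structure constants `c` and constant components `P`. -/
def christoffelAlg (c : Fin 3 → Fin 3 → Fin 3 → ℝ) (P : Matrix (Fin 3) (Fin 3) ℝ)
    (i j k : Fin 3) : ℝ :=
  ∑ l, koszulAlg c P i j l * P⁻¹ l k

/-- The Ricci components attached to structure constants `c` and constant components `P`. -/
def ricciAlg (c : Fin 3 → Fin 3 → Fin 3 → ℝ) (P : Matrix (Fin 3) (Fin 3) ℝ) (j k : Fin 3) : ℝ :=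
  ∑ i, (∑ p, christoffelAlg c P j k p * christoffelAlg c P i p i
    - ∑ p, christoffelAlg c P i k p * christoffelAlg c P j p i
    - ∑ p, c i j p * christoffelAlg c P p k i)

/-- The components `∇_l R_{mj}` attached to structure constants `c` and constant components `P`. -/
def covRicciAlg (c : Fin 3 → Fin 3 → Fin 3 → ℝ) (P : Matrix (Fin 3) (Fin 3) ℝ)
    (l m j : Fin 3) : ℝ :=
  - ∑ p, christoffelAlg c P l m p * ricciAlg c P p j
    - ∑ p, christoffelAlg c P l j p * ricciAlg c P m p

end Algebraic

section Manifold

variable {M : Type*} [TopologicalSpace M] [ChartedSpace E3 M]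

lemma dirDeriv_const (X : VField M) (a : ℝ) (x : M) : dirDeriv X (fun _ => a) x = 0 := by
  rw [dirDeriv, mfderiv_const]
  rfl

variable [IsManifold (𝓡 3) ∞ M] {g : Metric M} {F : Fin 3 → VField M}
  {c : Fin 3 → Fin 3 → Fin 3 → ℝ} {P : Matrix (Fin 3) (Fin 3) ℝ}

lemma pair_sum_left {ι : Type*} (s : Finset ι) (a : ι → ℝ) (X : ι → VField M) (Y : VField M)
    (x : M) : pair g (∑ k ∈ s, a k • X k) Y x = ∑ k ∈ s, a k * pair g (X k) Y x := by
  simp only [pair, Finset.sum_apply, Pi.smul_apply, map_sum, map_smul]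
  simp

lemma pair_eq (hP : ∀ x, gram g F x = P) (i j : Fin 3) : pair g (F i) (F j) = fun _ => P i j := by
  funext x
  rw [← hP x]
  rfl

lemma pair_bracket (hP : ∀ x, gram g F x = P) (hc : ∀ i j, bracket (F i) (F j) = ∑ k, c i j k • F k)
    (i j l : Fin 3) (x : M) : pair g (bracket (F i) (F j)) (F l) x = ∑ k, c i j k * P k l := by
  rw [hc, pair_sum_left]
  simp only [pair_eq hP]

lemma koszul_eq (hP : ∀ x, gram g F x = P) (hc : ∀ i j, bracket (F i) (F j) = ∑ k, c i j k • F k)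
    (i j l : Fin 3) (x : M) : koszul g (F i) (F j) (F l) x = koszulAlg c P i j l := by
  simp only [koszul, pair_bracket hP hc, pair_eq hP, dirDeriv_const, koszulAlg]
  ring

lemma christoffel_eq (hP : ∀ x, gram g F x = P)
    (hc : ∀ i j, bracket (F i) (F j) = ∑ k, c i j k • F k) (i j k : Fin 3) :
    christoffel g F i j k = fun _ => christoffelAlg c P i j k := by
  funext x
  simp only [christoffel, koszul_eq hP hc, gramInv, hP, christoffelAlg]

lemma structFun_eq (hP : ∀ x, gram g F x = P) (hdet : P.det ≠ 0)
    (hc : ∀ i j, bracket (F i) (F j) = ∑ k, c i j k • F k) (i j k : Fin 3) (x : M) :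
    structFun g F i j k x = c i j k := by
  have h := Matrix.mul_nonsing_inv P (isUnit_iff_ne_zero.2 hdet)
  have h2 : ∀ p, ∑ l, P p l * P⁻¹ l k = if p = k then 1 else 0 := fun p => by
    rw [← Matrix.mul_apply, h, Matrix.one_apply]
  simp only [structFun, pair_bracket hP hc, gramInv, hP, Finset.sum_mul]
  rw [Finset.sum_comm]
  simp only [mul_assoc, ← Finset.mul_sum, h2]
  simp

lemma ricci_eq (hP : ∀ x, gram g F x = P) (hdet : P.det ≠ 0)
    (hc : ∀ i j, bracket (F i) (F j) = ∑ k, c i j k • F k) (j k : Fin 3) :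
    ricci g F j k = fun _ => ricciAlg c P j k := by
  funext x
  simp only [ricci, riem, christoffel_eq hP hc, structFun_eq hP hdet hc, dirDeriv_const, ricciAlg]
  simp

lemma scalarCurv_eq (hP : ∀ x, gram g F x = P) (hdet : P.det ≠ 0)
    (hc : ∀ i j, bracket (F i) (F j) = ∑ k, c i j k • F k) :
    scalarCurv g F = fun _ => ∑ j, ∑ k, P⁻¹ j k * ricciAlg c P j k := by
  funext x
  simp only [scalarCurv, gramInv, hP, ricci_eq hP hdet hc]

lemma covRicci_eq (hP : ∀ x, gram g F x = P) (hdet : P.det ≠ 0)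
    (hc : ∀ i j, bracket (F i) (F j) = ∑ k, c i j k • F k) (l m j : Fin 3) (x : M) :
    covRicci g F l m j x = covRicciAlg c P l m j := by
  simp only [covRicci, christoffel_eq hP hc, ricci_eq hP hdet hc, dirDeriv_const, covRicciAlg]
  ring

lemma cottonYork_eq (hP : ∀ x, gram g F x = P) (hdet : P.det ≠ 0)
    (hc : ∀ i j, bracket (F i) (F j) = ∑ k, c i j k • F k) (i j : Fin 3) (x : M) :
    cottonYork g F i j x =
      ∑ k, ∑ l, ∑ m, P i k * (eta k l m / √P.det) * covRicciAlg c P l m j := by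
  simp only [cottonYork, hP, covRicci_eq hP hdet hc, scalarCurv_eq hP hdet hc, dirDeriv_const]
  simp

end Manifold

/-! ### Connection and Ricci components of `diag(A, B, B)` in a Milnor frame. -/

section Milnor

/-- The structure constants of a Milnor frame with `λ = -1`, `μ = ν = 1`. -/
def milnorConst (i j k : Fin 3) : ℝ := eta i j k * (2 * ![-1, 1, 1] k)

lemma eta_eq (k l m : Fin 3) : eta k l m =
    ![![![0, 0, 0], ![0, 0, 1], ![0, -1, 0]], ![![0, 0, -1], ![0, 0, 0], ![1, 0, 0]],
      ![![0, 1, 0], ![-1, 0, 0], ![0, 0, 0]]] k l m := by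
  rw [eta, Matrix.det_fin_three]
  fin_cases k <;> fin_cases l <;> fin_cases m <;> simp [Matrix.one_apply]

lemma inv_diagonal_three {A B C : ℝ} (hA : A ≠ 0) (hB : B ≠ 0) (hC : C ≠ 0) :
    (Matrix.diagonal ![A, B, C])⁻¹ = Matrix.diagonal ![A⁻¹, B⁻¹, C⁻¹] := by
  apply Matrix.inv_eq_right_inv
  rw [Matrix.diagonal_mul_diagonal, ← Matrix.diagonal_one]
  congr 1
  funext i
  fin_cases i <;> simp [hA, hB, hC]

lemma det_diagonal_three (A B C : ℝ) : (Matrix.diagonal ![A, B, C]).det = A * B * C := by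
  simp [Matrix.det_diagonal, Fin.prod_univ_three]

variable {A B : ℝ}

/-- With signs `s = (-1, 1, 1)` and `{i, j, k}` all three indices, Koszul gives `s_j P_j + s_k P_k -
s_i P_i`, which is `2B + A` for the first index and `-A` for the others. -/
lemma christoffelAlg_diagonal (hA : A ≠ 0) (hB : B ≠ 0) (i j k : Fin 3) :
    christoffelAlg milnorConst (Matrix.diagonal ![A, B, B]) i j k =
      eta i j k * ![2 * B + A, -A, -A] i * ![A⁻¹, B⁻¹, B⁻¹] k := by
  rw [christoffelAlg, inv_diagonal_three hA hB hB]
  fin_cases i <;> fin_cases j <;> fin_cases k <;>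
    simp [koszulAlg, milnorConst, eta_eq, Matrix.diagonal_apply] <;> ring_nf <;> simp

lemma ricciAlg_diagonal (hA : A ≠ 0) (hB : B ≠ 0) (i j : Fin 3) :
    ricciAlg milnorConst (Matrix.diagonal ![A, B, B]) i j =
      Matrix.diagonal ![2 * A ^ 2 / B ^ 2, -4 - 2 * A / B, -4 - 2 * A / B] i j := by
  simp only [ricciAlg, christoffelAlg_diagonal hA hB]
  fin_cases i <;> fin_cases j <;>
    simp [Fin.sum_univ_three, milnorConst, eta_eq] <;> field_simp <;> ring

/-- As Ricci is diagonal and the connection totally off-diagonal, only differences of principal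
Ricci curvatures survive. -/
lemma covRicciAlg_diagonal (hA : A ≠ 0) (hB : B ≠ 0) (l m j : Fin 3) :
    covRicciAlg milnorConst (Matrix.diagonal ![A, B, B]) l m j =
      eta l m j * ![2 * B + A, -A, -A] l *
        (![2 * A / B ^ 2, (-4 - 2 * A / B) / B, (-4 - 2 * A / B) / B] m
          - ![2 * A / B ^ 2, (-4 - 2 * A / B) / B, (-4 - 2 * A / B) / B] j) := by
  simp only [covRicciAlg, christoffelAlg_diagonal hA hB, ricciAlg_diagonal hA hB]
  fin_cases l <;> fin_cases m <;> fin_cases j <;>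
    simp [eta_eq, Matrix.diagonal_apply] <;> field_simp <;> ring

end Milnor

/-! ### The Cotton-York tensor of `diag(A, B, B)`. -/

section ManifoldMilnor

variable {M : Type*} [TopologicalSpace M] [ChartedSpace E3 M] [IsManifold (𝓡 3) ∞ M]
  {g : Metric M} {F : Fin 3 → VField M} {A B : ℝ}

lemma cottonYork_diagonal (hA : 0 < A) (hB : 0 < B)
    (hP : ∀ x, gram g F x = Matrix.diagonal ![A, B, B])
    (hc : ∀ i j, bracket (F i) (F j) = ∑ k, milnorConst i j k • F k) (i j : Fin 3) (x : M) :
    cottonYork g F i j x = 4 * A * (A + B) / (B ^ 2 * √(A * B * B)) *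
      Matrix.diagonal ![2 * A, -B, -B] i j := by
  have hdet : (Matrix.diagonal ![A, B, B]).det ≠ 0 := by
    rw [det_diagonal_three]; positivity
  simp only [cottonYork_eq hP hdet hc, covRicciAlg_diagonal hA.ne' hB.ne', det_diagonal_three]
  have hs : √(A * B * B) ≠ 0 := by positivity
  have hA' := hA.ne'
  have hB' := hB.ne'
  generalize √(A * B * B) = s at hs ⊢
  fin_cases i <;> fin_cases j <;>
    simp [Fin.sum_univ_three, eta_eq, Matrix.diagonal_apply] <;> field_simp <;> ring

/-- Raising an index turns `diag(2A, -B, -B)` into `diag(2, -1, -1)`, of norm `√6`. The factor `√(A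
* B * B)` on the left is the volume density relative to `h`. -/
lemma cottonYorkNorm_diagonal (hA : 0 < A) (hB : 0 < B)
    (hP : ∀ x, gram g F x = Matrix.diagonal ![A, B, B])
    (hc : ∀ i j, bracket (F i) (F j) = ∑ k, milnorConst i j k • F k) (x : M) :
    cottonYorkNorm g F x * √(A * B * B) = 4 * √6 * (A / B) * (1 + A / B) := by
  have hs : 0 < √(A * B * B) := by positivity
  have key : ∑ i, ∑ j, ∑ p, ∑ q, gramInv g F x i p * gramInv g F x j q *
      cottonYork g F i j x * cottonYork g F p q x =
      (4 * √6 * (A / B) * (1 + A / B) / √(A * B * B)) ^ 2 := by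
    simp only [cottonYork_diagonal hA hB hP hc, gramInv, hP,
      inv_diagonal_three hA.ne' hB.ne' hB.ne', Fin.sum_univ_three]
    have hA' := hA.ne'
    have hB' := hB.ne'
    have h6 : √6 ^ 2 = (6 : ℝ) := Real.sq_sqrt (by norm_num)
    simp only [div_pow, mul_pow, h6]
    generalize √(A * B * B) = s at hs ⊢
    have hs' := hs.ne'
    simp
    field_simp
    ring
  rw [cottonYorkNorm, key, Real.sqrt_sq (by positivity)]
  field_simp

end ManifoldMilnor

/-! ### Uniqueness of solutions of autonomous differential equations -/

section Uniqueness

/-- Two solutions on `[0, ∞)` of an autonomous differential equation that stay in a set on which the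
vector field is `C^1` agree if they have the same initial value. -/
theorem eq_of_hasDerivWithinAt_Ici {V : Type*} [NormedAddCommGroup V] [NormedSpace ℝ V]
    {f : V → V} {U : Set V} (hf : ∀ v ∈ U, ContDiffAt ℝ 1 f v) {y z : ℝ → V}
    (hy : ∀ t, 0 ≤ t → HasDerivWithinAt y (f (y t)) (Set.Ici 0) t)
    (hz : ∀ t, 0 ≤ t → HasDerivWithinAt z (f (z t)) (Set.Ici 0) t)
    (hyU : ∀ t, 0 ≤ t → y t ∈ U) (hzU : ∀ t, 0 ≤ t → z t ∈ U) (h0 : y 0 = z 0)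
    {t : ℝ} (ht : 0 ≤ t) : y t = z t := by
  have hyc : ContinuousOn y (Set.Icc 0 t) := fun s hs =>
    ((hy s hs.1).continuousWithinAt).mono Set.Icc_subset_Ici_self
  have hzc : ContinuousOn z (Set.Icc 0 t) := fun s hs =>
    ((hz s hs.1).continuousWithinAt).mono Set.Icc_subset_Ici_self
  -- The two trajectories form a compact set, on which a locally Lipschitz field is Lipschitz.
  set S : Set V := y '' Set.Icc 0 t ∪ z '' Set.Icc 0 t with hS
  have hSc : IsCompact S := (isCompact_Icc.image_of_continuousOn hyc).union
    (isCompact_Icc.image_of_continuousOn hzc)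
  have hSU : S ⊆ U := by
    rintro _ (⟨s, hs, rfl⟩ | ⟨s, hs, rfl⟩)
    exacts [hyU s hs.1, hzU s hs.1]
  have hloc : LocallyLipschitzOn S f := fun v hv => by
    obtain ⟨K, N, hN, hK⟩ := (hf v (hSU hv)).exists_lipschitzOnWith
    exact ⟨K, N, mem_nhdsWithin_of_mem_nhds hN, hK⟩
  obtain ⟨K, hK⟩ := hloc.exists_lipschitzOnWith_of_compact hSc
  refine ODE_solution_unique_of_mem_Icc_right (v := fun _ => f) (s := fun _ => S) (K := K)
    (fun _ _ => hK) hyc (fun s hs => (hy s hs.1).mono (Set.Ici_subset_Ici.2 hs.1))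
    (fun s hs => Or.inl ⟨s, Set.Ico_subset_Icc_self hs, rfl⟩) hzc
    (fun s hs => (hz s hs.1).mono (Set.Ici_subset_Ici.2 hs.1))
    (fun s hs => Or.inr ⟨s, Set.Ico_subset_Icc_self hs, rfl⟩) h0 ⟨ht, le_rfl⟩

end Uniqueness

/-! ### Smooth dependence of the Ricci components on the Gram matrix. -/

section Smoothness

variable (c : Fin 3 → Fin 3 → Fin 3 → ℝ) {p : Fin 3 → Fin 3 → ℝ}

lemma contDiffAt_matrix_inv_apply (hp : (Matrix.of p).det ≠ 0) (l k : Fin 3) :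
    ContDiffAt ℝ 1 (fun q : Fin 3 → Fin 3 → ℝ => (Matrix.of q)⁻¹ l k) p := by
  have hdet : ContDiff ℝ 1 (fun q : Fin 3 → Fin 3 → ℝ => (Matrix.of q).det) := by
    simp only [Matrix.det_fin_three, Matrix.of_apply]
    fun_prop
  have hadj : ContDiff ℝ 1 (fun q : Fin 3 → Fin 3 → ℝ => (Matrix.of q).adjugate l k) := by
    simp only [Matrix.adjugate_fin_three]
    fin_cases l <;> fin_cases k <;> simp <;> fun_prop
  simp only [Matrix.inv_def, Ring.inverse_eq_inv', Matrix.smul_apply, smul_eq_mul]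
  exact (hdet.contDiffAt.inv hp).mul hadj.contDiffAt

lemma contDiffAt_christoffelAlg (hp : (Matrix.of p).det ≠ 0) (i j k : Fin 3) :
    ContDiffAt ℝ 1 (fun q : Fin 3 → Fin 3 → ℝ => christoffelAlg c (Matrix.of q) i j k) p := by
  have hk : ∀ l, ContDiff ℝ 1 (fun q : Fin 3 → Fin 3 → ℝ => koszulAlg c (Matrix.of q) i j l) :=
    fun l => by
      simp only [koszulAlg, Matrix.of_apply]
      fun_prop
  exact ContDiffAt.sum fun l _ => (hk l).contDiffAt.mul (contDiffAt_matrix_inv_apply hp l k)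

/-- The right-hand side of the Ricci flow on left-invariant metrics. -/
def ricciVectorField (p : Fin 3 → Fin 3 → ℝ) : Fin 3 → Fin 3 → ℝ :=
  fun i j => -2 * ricciAlg c (Matrix.of p) i j

lemma contDiffAt_ricciVectorField (hp : (Matrix.of p).det ≠ 0) :
    ContDiffAt ℝ 1 (ricciVectorField c) p := by
  have h := contDiffAt_christoffelAlg c hp
  refine contDiffAt_pi.2 fun j => contDiffAt_pi.2 fun k => ?_
  simp only [ricciVectorField, ricciAlg]
  fun_prop

end Smoothness

/-! ### The explicit solution -/

section Explicit

/-- An antiderivative of `sinh ^ 2`. -/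
def sinhSqPrimitive (x : ℝ) : ℝ := Real.sinh x * Real.cosh x / 2 - x / 2

lemma hasDerivAt_sinhSqPrimitive (x : ℝ) :
    HasDerivAt sinhSqPrimitive (Real.sinh x ^ 2) x := by
  have h := ((((Real.hasDerivAt_sinh x).mul (Real.hasDerivAt_cosh x)).div_const 2).sub
    ((hasDerivAt_id x).div_const 2))
  refine h.congr_deriv ?_
  have := Real.cosh_sq x
  linear_combination this / 2

lemma strictMonoOn_sinhSqPrimitive : StrictMonoOn sinhSqPrimitive (Set.Ici 0) := by
  refine strictMonoOn_of_deriv_pos (convex_Ici 0)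
    (fun x _ => (hasDerivAt_sinhSqPrimitive x).continuousAt.continuousWithinAt) fun x hx => ?_
  rw [interior_Ici] at hx
  rw [(hasDerivAt_sinhSqPrimitive x).deriv]
  have := Real.sinh_pos_iff.2 hx
  positivity

lemma tendsto_sinhSqPrimitive : Filter.Tendsto sinhSqPrimitive Filter.atTop Filter.atTop := by
  refine Filter.tendsto_atTop_mono' _ ?_ Filter.tendsto_id
  -- For `x ≥ 3` one has `x² / 2 - x / 2 ≥ x`.
  filter_upwards [Filter.eventually_ge_atTop 3] with x hx
  have h1 : x ≤ Real.sinh x := Real.self_le_sinh_iff.2 (by linarith)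
  have h2 : Real.sinh x < Real.cosh x := Real.sinh_lt_cosh x
  have h3 : x * x ≤ Real.sinh x * Real.cosh x :=
    mul_le_mul h1 (h1.trans h2.le) (by linarith) (by linarith)
  simp only [sinhSqPrimitive, id]
  nlinarith

/-- The scalar differential equation `θ' = k / sinh² θ` has a global solution for `k > 0`. -/
lemma exists_hasDerivAt_div_sinh_sq {k a : ℝ} (hk : 0 < k) (ha : 0 < a) :
    ∃ θ : ℝ → ℝ, θ 0 = a ∧ ∀ t, 0 ≤ t → 0 < θ t ∧ HasDerivAt θ (k / Real.sinh (θ t) ^ 2) t := by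
  have hcont : Continuous sinhSqPrimitive :=
    continuous_iff_continuousAt.2 fun x => (hasDerivAt_sinhSqPrimitive x).continuousAt
  have hinj : StrictMono sinhSqPrimitive := by
    refine strictMono_of_odd_strictMonoOn_nonneg (fun x => ?_) strictMonoOn_sinhSqPrimitive
    simp only [sinhSqPrimitive, Real.sinh_neg, Real.cosh_neg]
    ring
  have hodd : ∀ x, sinhSqPrimitive (-x) = - sinhSqPrimitive x := fun x => by
    simp only [sinhSqPrimitive, Real.sinh_neg, Real.cosh_neg]
    ring
  have hbot : Filter.Tendsto sinhSqPrimitive Filter.atBot Filter.atBot := by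
    have := Filter.tendsto_neg_atTop_atBot.comp
      (tendsto_sinhSqPrimitive.comp Filter.tendsto_neg_atBot_atTop)
    refine this.congr fun x => ?_
    simp [hodd]
  have hsurj : Function.Surjective sinhSqPrimitive :=
    hcont.surjective tendsto_sinhSqPrimitive hbot
  let φ : ℝ ≃o ℝ := hinj.orderIsoOfSurjective _ hsurj
  have hφ : ∀ x, φ x = sinhSqPrimitive x := fun x => rfl
  -- Separation of variables: `sinh² θ dθ = k dt` integrates to `sinhSqPrimitive θ = sinhSqPrimitive
  -- a + k t`.
  refine ⟨fun t => φ.symm (sinhSqPrimitive a + k * t), ?_, fun t ht => ?_⟩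
  · simp [← hφ]
  · have hpos : 0 < φ.symm (sinhSqPrimitive a + k * t) := by
      refine ha.trans_le ?_
      rw [φ.le_symm_apply, hφ]
      have := mul_nonneg hk.le ht
      linarith
    refine ⟨hpos, ?_⟩
    set x := φ.symm (sinhSqPrimitive a + k * t) with hx
    have hs : Real.sinh x ^ 2 ≠ 0 := by
      have := Real.sinh_pos_iff.2 hpos
      positivity
    have h1 : HasDerivAt φ.symm (Real.sinh x ^ 2)⁻¹ (sinhSqPrimitive a + k * t) :=
      HasDerivAt.of_local_left_inverse φ.symm.continuous.continuousAt
        (hasDerivAt_sinhSqPrimitive x) hs (Filter.Eventually.of_forall fun y => by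
          rw [← hφ]; simp)
    have h2 : HasDerivAt (fun s => sinhSqPrimitive a + k * s) k t := by
      simpa using ((hasDerivAt_id t).const_mul k).const_add (sinhSqPrimitive a)
    refine (h1.comp t h2).congr_deriv ?_
    rw [div_eq_inv_mul]

/-- The system `A' = -4 A² / B²`, `B' = 8 + 4 A / B` has positive global solutions. -/
lemma exists_solution {A₀ B₀ : ℝ} (hA : 0 < A₀) (hB : 0 < B₀) :
    ∃ A B : ℝ → ℝ, A 0 = A₀ ∧ B 0 = B₀ ∧ ∀ t, 0 ≤ t → 0 < A t ∧ 0 < B t ∧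
      HasDerivAt A (-2 * (2 * A t ^ 2 / B t ^ 2)) t ∧
      HasDerivAt B (-2 * (-4 - 2 * A t / B t)) t := by
  -- Put `A / B = 1 / sinh² θ`. The conserved quantity `A² B / (A + B) = c²` then gives `A = c coth
  -- θ` and `B = c sinh θ cosh θ`, and the system becomes `θ' = (4 / c) / sinh² θ`.
  set a := Real.arsinh √(B₀ / A₀) with ha
  have hsa : Real.sinh a = √(B₀ / A₀) := Real.sinh_arsinh _
  have ha0 : 0 < a := by
    rw [← Real.sinh_pos_iff, hsa]; positivity
  have hca : 0 < Real.cosh a := Real.cosh_pos a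
  have hsa0 : 0 < Real.sinh a := Real.sinh_pos_iff.2 ha0
  set c := A₀ * Real.sinh a / Real.cosh a with hc
  have hc0 : 0 < c := by positivity
  obtain ⟨θ, hθ0, hθ⟩ := exists_hasDerivAt_div_sinh_sq (k := 4 / c) (by positivity) ha0
  refine ⟨fun t => c * Real.cosh (θ t) / Real.sinh (θ t),
    fun t => c * (Real.sinh (θ t) * Real.cosh (θ t)), ?_, ?_, fun t ht => ?_⟩
  · simp only [hθ0, hc]; field_simp
  · have : Real.sinh a ^ 2 = B₀ / A₀ := by rw [hsa, Real.sq_sqrt (by positivity)]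
    simp only [hθ0, hc]; field_simp; rw [this]; field_simp
  · obtain ⟨hpos, hd⟩ := hθ t ht
    have hs : 0 < Real.sinh (θ t) := Real.sinh_pos_iff.2 hpos
    have hcosh : 0 < Real.cosh (θ t) := Real.cosh_pos _
    have hid := Real.cosh_sq (θ t)
    have hcc := hc0.ne'
    have hs' := hs.ne'
    have hch' := hcosh.ne'
    refine ⟨by positivity, by positivity, ?_, ?_⟩
    · refine (((hd.cosh).const_mul c).div hd.sinh hs.ne').congr_deriv ?_
      field_simp
      linear_combination (-4) * hid
    · refine ((hd.sinh.mul hd.cosh).const_mul c).congr_deriv ?_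
      field_simp
      linear_combination (4) * hid

end Explicit

/-! ### Smooth tensor fields -/

section Smooth

variable {M : Type*} [TopologicalSpace M] [ChartedSpace E3 M] [IsManifold (𝓡 3) ∞ M]

/-- All tangent spaces unfold to `E3`, so the same vectors can be read at a propositionally equal
base point such as `y * 1`. -/
lemma inner_congr (g : Metric M) {x y : M} (h : x = y) (v w : E3) :
    g.inner x v w = g.inner y v w := by
  subst h; rfl

lemma contMDiff_inner_left (g : Metric M) {X : VField M}
    (hX : ContMDiff (𝓡 3) ((𝓡 3).prod (𝓡 3)) ∞ (fun x => (X x : TangentBundle (𝓡 3) M))) :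
    ContMDiff (𝓡 3) ((𝓡 3).prod 𝓘(ℝ, E3 →L[ℝ] ℝ)) ∞
      (fun x => TotalSpace.mk' (E3 →L[ℝ] ℝ)
        (E := fun x : M => TangentSpace (𝓡 3) x →L[ℝ] Bundle.Trivial M ℝ x) x
        (g.inner x (X x))) :=
  ContMDiff.clm_bundle_apply (F₁ := E3) (F₂ := E3 →L[ℝ] ℝ) (E₁ := TangentSpace (𝓡 3))
    (E₂ := fun x : M => TangentSpace (𝓡 3) x →L[ℝ] Bundle.Trivial M ℝ x) (b := fun x => x)
    g.contMDiff hX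

lemma contMDiff_smulRight {φ : ∀ x : M, TangentSpace (𝓡 3) x →L[ℝ] ℝ}
    (hφ : ContMDiff (𝓡 3) ((𝓡 3).prod 𝓘(ℝ, E3 →L[ℝ] ℝ)) ∞
      (fun x => TotalSpace.mk' (E3 →L[ℝ] ℝ)
        (E := fun x : M => TangentSpace (𝓡 3) x →L[ℝ] Bundle.Trivial M ℝ x) x (φ x))) :
    ContMDiff (𝓡 3) ((𝓡 3).prod 𝓘(ℝ, E3 →L[ℝ] E3 →L[ℝ] ℝ)) ∞
      (fun x => TotalSpace.mk' (E3 →L[ℝ] E3 →L[ℝ] ℝ)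
        (E := fun x : M => TangentSpace (𝓡 3) x →L[ℝ] TangentSpace (𝓡 3) x →L[ℝ] Bundle.Trivial M ℝ x)
        x ((φ x).smulRight (φ x))) := by
  intro x₀
  rw [contMDiffAt_hom_bundle]
  refine ⟨contMDiffAt_id, ?_⟩
  have h := ((contMDiffAt_hom_bundle _).1 (hφ x₀)).2
  -- In a trivialization the claim is smoothness of the quadratic map `q ↦ q ⊗ q` on a fixed space.
  have hq : ContDiff ℝ ∞ (fun q : E3 →L[ℝ] ℝ => q.smulRight q) := by fun_prop
  refine (hq.contMDiff.contMDiffAt.comp x₀ h).congr_of_eventuallyEq ?_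
  filter_upwards [(trivializationAt E3 (TangentSpace (𝓡 3)) x₀).open_baseSet.mem_nhds
    (FiberBundle.mem_baseSet_trivializationAt E3 (TangentSpace (𝓡 3)) x₀)] with x hx
  ext v w
  rw [inCoordinates_apply_eq₂ hx hx (by simp)]
  simp [ContinuousLinearMap.inCoordinates_eq hx]

end Smooth

/-! ### Left-invariant fields and metrics on the group. -/

section LieGroup

variable {G : Type*} [TopologicalSpace G] [ChartedSpace E3 G] [Group G] [LieGroup (𝓡 3) ∞ G]

/-- The value at `g` is the image of `(0_g, v)` under the tangent map of multiplication, a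
composition of smooth maps. -/
theorem contMDiff_mulInvariantVectorField_infty (v : GroupLieAlgebra (𝓡 3) G) :
    ContMDiff (𝓡 3) ((𝓡 3).prod (𝓡 3)) ∞
      (fun x => (mulInvariantVectorField v x : TangentBundle (𝓡 3) G)) := by
  let fg : G → TangentBundle (𝓡 3) G := fun g ↦ TotalSpace.mk' E3 g 0
  have sfg : ContMDiff (𝓡 3) (𝓡 3).tangent ∞ fg := contMDiff_zeroSection _ _
  let fv : G → TangentBundle (𝓡 3) G := fun _ ↦ TotalSpace.mk' E3 1 v
  have sfv : ContMDiff (𝓡 3) (𝓡 3).tangent ∞ fv := contMDiff_const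
  let F₁ : G → (TangentBundle (𝓡 3) G × TangentBundle (𝓡 3) G) := fun g ↦ (fg g, fv g)
  have S₁ : ContMDiff (𝓡 3) ((𝓡 3).tangent.prod (𝓡 3).tangent) ∞ F₁ := sfg.prodMk sfv
  let F₂ : (TangentBundle (𝓡 3) G × TangentBundle (𝓡 3) G) →
      TangentBundle ((𝓡 3).prod (𝓡 3)) (G × G) :=
    (equivTangentBundleProd (𝓡 3) G (𝓡 3) G).symm
  have S₂ : ContMDiff ((𝓡 3).tangent.prod (𝓡 3).tangent) ((𝓡 3).prod (𝓡 3)).tangent ∞ F₂ :=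
    contMDiff_equivTangentBundleProd_symm
  let F₃ : TangentBundle ((𝓡 3).prod (𝓡 3)) (G × G) → TangentBundle (𝓡 3) G :=
    tangentMap ((𝓡 3).prod (𝓡 3)) (𝓡 3) (fun (p : G × G) ↦ p.1 * p.2)
  have S₃ : ContMDiff ((𝓡 3).prod (𝓡 3)).tangent (𝓡 3).tangent ∞ F₃ :=
    ContMDiff.contMDiff_tangentMap (contMDiff_mul (𝓡 3) ∞) (m := ∞) le_rfl
  let S := (S₃.comp S₂).comp S₁
  convert! S with g
  · simp [F₁, F₂, F₃, fg, fv]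
  · simp only [Function.comp_apply, tangentMap, F₃, F₂, F₁, fg, fv]
    rw [mfderiv_prod_eq_add_apply ((contMDiff_mul (𝓡 3) ∞).mdifferentiableAt (by simp))]
    change mulInvariantVectorField v g =
      mfderiv (𝓡 3) (𝓡 3) (fun z : G => z * 1) g 0 + mfderiv (𝓡 3) (𝓡 3) (fun z : G => g * z) 1 v
    rw [map_zero]
    exact (zero_add _).symm

lemma lieGroup_minSmoothness : LieGroup (𝓡 3) (minSmoothness ℝ 3) G := by
  rw [minSmoothness_of_isRCLikeNormedField]
  infer_instance

lemma bracket_mulInvariantVectorField (v w : GroupLieAlgebra (𝓡 3) G) :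
    bracket (mulInvariantVectorField v) (mulInvariantVectorField w) =
      mulInvariantVectorField ⁅v, w⁆ := by
  have := lieGroup_minSmoothness (G := G)
  exact (mulInvariantVector_mlieBracket v w).symm

lemma bracket_frame {e : Module.Basis (Fin 3) ℝ (GroupLieAlgebra (𝓡 3) G)}
    (he : MilnorRelations e (-1) 1 1) (i j : Fin 3) :
    bracket (frame e i) (frame e j) = ∑ k, milnorConst i j k • frame e k := by
  have := lieGroup_minSmoothness (G := G)
  have h1 := he.rel1
  have h2 := he.rel2
  have h3 := he.rel3
  have h1' : ⁅e 2, e 1⁆ = -((2 * (-1 : ℝ)) • e 0) := by rw [← h1, lie_skew]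
  have h2' : ⁅e 0, e 2⁆ = -((2 * (1 : ℝ)) • e 1) := by rw [← h2, lie_skew]
  have h3' : ⁅e 1, e 0⁆ = -((2 * (1 : ℝ)) • e 2) := by rw [← h3, lie_skew]
  have hb : ⁅e i, e j⁆ = ∑ k, milnorConst i j k • e k := by
    fin_cases i <;> fin_cases j <;>
      simp [Fin.sum_univ_three, milnorConst, eta_eq, h1, h2, h3, h1', h2', h3', neg_smul]
  simp only [frame, bracket_mulInvariantVectorField, hb, Fin.sum_univ_three,
    mulInvariantVectorField_add, mulInvariantVectorField_smul]

lemma gram_eq_gram_one {g : Metric G} (hg : IsLeftInvariant g)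
    (e : Module.Basis (Fin 3) ℝ (GroupLieAlgebra (𝓡 3) G)) (x : G) :
    gram g (frame e) x = gram g (frame e) 1 := by
  have key : ∀ y i j, gram g (frame e) y i j = g.inner 1 (e i) (e j) := fun y i j => by
    rw [← hg y 1 (e i) (e j)]
    exact inner_congr g (mul_one y).symm _ _
  ext i j
  rw [key, key]

lemma mfderiv_mul_left_frame (e : Module.Basis (Fin 3) ℝ (GroupLieAlgebra (𝓡 3) G)) (a x : G)
    (i : Fin 3) :
    mfderiv (𝓡 3) (𝓡 3) (fun y : G => a * y) x (frame e i x) = frame e i (a * x) := by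
  have h : (fun y : G => a * x * y) = (fun y => a * y) ∘ (fun y => x * y) := by
    funext y; simp [mul_assoc]
  have hd : ∀ b y : G, MDifferentiableAt (𝓡 3) (𝓡 3) (fun y : G => b * y) y := fun b y =>
    (contMDiff_mul_left (I := 𝓡 3) (n := ∞) (a := b)).contMDiffAt.mdifferentiableAt (by simp)
  -- The chain rule for `L_{ax} = L_a ∘ L_x` at `1` produces the base point `x * 1` in place of `x`.
  have hbase : ∀ y : G, y = x → ∀ v : E3, mfderiv (𝓡 3) (𝓡 3) (fun z : G => a * z) x v =
      (mfderiv (𝓡 3) (𝓡 3) (fun z : G => a * z) y v : E3) := by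
    rintro _ rfl v; rfl
  have hcomp := mfderiv_comp (I := 𝓡 3) (I' := 𝓡 3) (I'' := 𝓡 3) (1 : G) (hd a (x * 1)) (hd x 1)
  have h2 : (mfderiv (𝓡 3) (𝓡 3) (fun y : G => a * x * y) 1 (e i) : E3) =
      mfderiv (𝓡 3) (𝓡 3) (fun z : G => a * z) (x * 1)
        (mfderiv (𝓡 3) (𝓡 3) (fun y : G => x * y) 1 (e i)) := by
    rw [h, hcomp]; rfl
  exact (hbase (x * 1) (mul_one x) _).trans h2.symm

end LieGroup

/-! ### Deforming a metric along a vector field -/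

section Deform

variable {M : Type*} [TopologicalSpace M] [ChartedSpace E3 M] [IsManifold (𝓡 3) ∞ M]

lemma inner_sq_le (g : Metric M) {x : M} {u : TangentSpace (𝓡 3) x} {N : ℝ} (hN : 0 < N)
    (hu : g.inner x u u = N) (v : TangentSpace (𝓡 3) x) :
    g.inner x u v ^ 2 ≤ N * g.inner x v v := by
  have hnonneg : ∀ w : TangentSpace (𝓡 3) x, 0 ≤ g.inner x w w := fun w => by
    by_cases hw : w = 0
    · simp [hw]
    · exact (g.pos x w hw).le
  -- Cauchy-Schwarz: this vector has square norm `N (N g(v,v) - g(u,v)²)`.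
  have h := hnonneg (N • v - g.inner x u v • u)
  have hs := g.symm x v u
  simp only [map_sub, map_smul, FunLike.coe_sub, FunLike.coe_smul,
    Pi.sub_apply, Pi.smul_apply, smul_eq_mul, hu, hs] at h
  nlinarith

/-- The deformed form is `α g` on the complement of `u` and `(α + β N) g` along `u`. The lower bound
yields both positivity and bounded unit balls. -/
lemma le_deform (g : Metric M) {x : M} {u : TangentSpace (𝓡 3) x} {N α β : ℝ} (hN : 0 < N)
    (hu : g.inner x u u = N) (v : TangentSpace (𝓡 3) x) :
    min α (α + β * N) * g.inner x v v ≤ α * g.inner x v v + β * g.inner x u v ^ 2 := by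
  have h1 := inner_sq_le g hN hu v
  have h2 : 0 ≤ g.inner x v v := by
    by_cases hv : v = 0
    · simp [hv]
    · exact (g.pos x v hv).le
  rcases le_total 0 β with hβ | hβ
  · have := mul_nonneg hβ (sq_nonneg (g.inner x u v))
    have := mul_le_mul_of_nonneg_right (min_le_left α (α + β * N)) h2
    linarith
  · have := mul_le_mul_of_nonpos_left h1 hβ
    have := mul_le_mul_of_nonneg_right (min_le_right α (α + β * N)) h2
    linarith

/-- The metric `α g + β θ ⊗ θ`, where `θ = g(X, ·)` for a vector field `X` with `g(X, X) = N`. -/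
def deform (g : Metric M) (X : VField M)
    (hX : ContMDiff (𝓡 3) ((𝓡 3).prod (𝓡 3)) ∞ (fun x => (X x : TangentBundle (𝓡 3) M)))
    {N α β : ℝ} (hN : 0 < N) (hXN : ∀ x, g.inner x (X x) (X x) = N) (hα : 0 < α)
    (hβ : 0 < α + β * N) : Metric M where
  inner x := α • g.inner x + β • (g.inner x (X x)).smulRight (g.inner x (X x))
  symm x v w := by
    simp only [add_apply, smul_apply, ContinuousLinearMap.smulRight_apply, smul_eq_mul,
      g.symm x v w]
    ring
  pos x v hv := by
    have h := le_deform g (α := α) (β := β) hN (hXN x) v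
    have := mul_pos (lt_min hα hβ) (g.pos x v hv)
    simp
    nlinarith
  isVonNBounded x := by
    have hm : 0 < min α (α + β * N) := lt_min hα hβ
    -- With `m` the minimum, the new unit ball lies in the `1/√m`-dilate of that of `g`.
    refine ((g.isVonNBounded x).image
      ((√(min α (α + β * N)))⁻¹ • ContinuousLinearMap.id ℝ (TangentSpace (𝓡 3) x))).subset
      fun v hv => ?_
    have h := le_deform g (α := α) (β := β) hN (hXN x) v
    have hs : 0 < √(min α (α + β * N)) := Real.sqrt_pos.2 hm
    refine ⟨√(min α (α + β * N)) • v, ?_, ?_⟩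
    · simp at hv
      have : √(min α (α + β * N)) * √(min α (α + β * N)) = min α (α + β * N) :=
        Real.mul_self_sqrt hm.le
      simp [← mul_assoc, this]
      nlinarith
    · simp [smul_smul, hs.ne']
  contMDiff := by
    have h1 := g.contMDiff
    have h2 := contMDiff_smulRight (contMDiff_inner_left g hX)
    exact (h1.const_smul_section (a := α)).add_section (h2.const_smul_section (a := β))

end Deform

section LieGroup

variable {G : Type*} [TopologicalSpace G] [ChartedSpace E3 G] [Group G] [LieGroup (𝓡 3) ∞ G]
  {e : Module.Basis (Fin 3) ℝ (GroupLieAlgebra (𝓡 3) G)}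

lemma exists_isLeftInvariantDiagonal {g₀ : Metric G} {A₀ B₀ A B : ℝ} (hA₀ : 0 < A₀) (hB₀ : 0 < B₀)
    (hg₀ : IsLeftInvariantDiagonal g₀ e A₀ B₀ B₀) (hA : 0 < A) (hB : 0 < B) :
    ∃ g : Metric G, IsLeftInvariantDiagonal g e A B B := by
  have hgram : ∀ x i j, g₀.inner x (frame e i x) (frame e j x) =
      Matrix.diagonal ![A₀, B₀, B₀] i j := fun x i j => by
    rw [← hg₀.2 x]; rfl
  -- `α` rescales `B₀` to `B`; `β` solves `α A₀ + β A₀² = A`, so `α + β A₀ = A / A₀ > 0`.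
  refine ⟨deform g₀ (frame e 0) (contMDiff_mulInvariantVectorField_infty _) (N := A₀)
    (α := B / B₀) (β := (A / A₀ - B / B₀) / A₀) hA₀ (fun x => by simp [hgram]) (by positivity)
    (by field_simp; ring_nf; positivity), ?_, fun x => ?_⟩
  · intro a x v w
    have h : ∀ v : TangentSpace (𝓡 3) x, g₀.inner (a * x) (frame e 0 (a * x))
        (mfderiv (𝓡 3) (𝓡 3) (fun y : G => a * y) x v) = g₀.inner x (frame e 0 x) v := fun v => by
      rw [← mfderiv_mul_left_frame]
      exact hg₀.1 a x _ _
    simp [deform, h, hg₀.1 a x]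
  · ext i j
    have := hgram x i j
    simp only [gram, pair, deform, Matrix.of_apply]
    simp [hgram]
    fin_cases i <;> fin_cases j <;> simp
    all_goals field_simp
    all_goals ring

end LieGroup

/-! ### Non-degenerate Gram matrices and linear independence. -/

section Frame

variable {M : Type*} [TopologicalSpace M] [ChartedSpace E3 M] [IsManifold (𝓡 3) ∞ M]
  {F : Fin 3 → VField M} {x : M}

lemma linearIndependent_of_det_gram_ne_zero {g : Metric M} (hdet : (gram g F x).det ≠ 0) :
    LinearIndependent ℝ (fun i => F i x) := by
  rw [Fintype.linearIndependent_iff]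
  intro a ha
  have h : Matrix.vecMul a (gram g F x) = 0 := by
    funext j
    have : g.inner x (∑ i, a i • F i x) (F j x) = 0 := by rw [ha]; simp
    simpa [Matrix.vecMul, dotProduct, gram, pair] using this
  have := Matrix.eq_zero_of_vecMul_eq_zero hdet h
  exact fun i => congrFun this i

/-- Independence does not involve the metric, so non-degeneracy passes from one metric to all
others. -/
lemma det_gram_ne_zero_of_linearIndependent (g : Metric M)
    (hli : LinearIndependent ℝ (fun i => F i x)) : (gram g F x).det ≠ 0 := by
  intro hdet
  obtain ⟨a, ha0, ha⟩ := Matrix.exists_vecMul_eq_zero_iff.2 hdet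
  have hj : ∀ j, g.inner x (∑ i, a i • F i x) (F j x) = 0 := fun j => by
    have := congrFun ha j
    simpa [Matrix.vecMul, dotProduct, gram, pair] using this
  have hself : g.inner x (∑ i, a i • F i x) (∑ i, a i • F i x) = 0 := by
    rw [map_sum]
    exact Finset.sum_eq_zero fun j _ => by rw [map_smul, hj, smul_zero]
  have hzero : ∑ i, a i • F i x = 0 := by
    by_contra hne
    exact (g.pos x _ hne).ne' hself
  exact ha0 (funext fun i => Fintype.linearIndependent_iff.1 hli a hzero i)

/-- A frame with non-degenerate Gram matrix spans each tangent space. -/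
lemma exists_coeff {g : Metric M} (hdet : (gram g F x).det ≠ 0) (v : TangentSpace (𝓡 3) x) :
    ∃ a : Fin 3 → ℝ, v = ∑ i, a i • F i x := by
  have hli := linearIndependent_of_det_gram_ne_zero hdet
  have : FiniteDimensional ℝ (TangentSpace (𝓡 3) x) := inferInstanceAs (FiniteDimensional ℝ E3)
  have hspan := hli.span_eq_top_of_card_eq_finrank' (by
    change _ = Module.finrank ℝ E3
    simp)
  have hv : v ∈ Submodule.span ℝ (Set.range fun i => F i x) := by rw [hspan]; trivial
  obtain ⟨a, ha⟩ := (Submodule.mem_span_range_iff_exists_fun ℝ).1 hv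
  exact ⟨a, ha.symm⟩

end Frame

/-! ### The Riemannian volume measure -/

section Volume

variable {M : Type*} [TopologicalSpace M] [ChartedSpace E3 M] [IsManifold (𝓡 3) ∞ M]

lemma inner_sum_sum (g : Metric M) {x : M} {n : ℕ} (a b : Fin n → ℝ)
    (u : Fin n → TangentSpace (𝓡 3) x) :
    g.inner x (∑ k, a k • u k) (∑ l, b l • u l) =
      ∑ k, ∑ l, a k * g.inner x (u k) (u l) * b l := by
  simp only [map_sum, map_smul, _root_.sum_apply, smul_apply, smul_eq_mul, Finset.mul_sum]
  rw [Finset.sum_comm]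
  refine Finset.sum_congr rfl fun k _ => Finset.sum_congr rfl fun l _ => ?_
  ring

/-- The change of the determinant of a Gram matrix under a change of vectors. -/
lemma det_inner_sum (g : Metric M) {x : M} (u : Fin 3 → TangentSpace (𝓡 3) x)
    (J : Matrix (Fin 3) (Fin 3) ℝ) :
    (Matrix.of fun i j => g.inner x (∑ k, J k i • u k) (∑ l, J l j • u l)).det =
      J.det ^ 2 * (Matrix.of fun i j => g.inner x (u i) (u j)).det := by
  have : (Matrix.of fun i j => g.inner x (∑ k, J k i • u k) (∑ l, J l j • u l)) =
      J.transpose * (Matrix.of fun i j => g.inner x (u i) (u j)) * J := by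
    ext i j
    simp only [Matrix.of_apply, inner_sum_sum, Matrix.mul_apply, Matrix.transpose_apply,
      Finset.sum_mul]
    rw [Finset.sum_comm]
  rw [this, Matrix.det_mul, Matrix.det_mul, Matrix.det_transpose]
  ring

/-- Expanding the coordinate vectors in the frame multiplies both Gram determinants by the same
squared determinant. -/
lemma volDensity_eq_sqrt_mul {g h : Metric M} {F : Fin 3 → VField M}
    {P : Matrix (Fin 3) (Fin 3) ℝ} (hg : ∀ x, gram g F x = P) (hh : ∀ x, gram h F x = 1)
    (hP : 0 ≤ P.det) (e : OpenPartialHomeomorph M E3) (y : E3) :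
    volDensity g e y = √P.det * volDensity h e y := by
  have hdet : (gram h F (e.symm y)).det ≠ 0 := by simp [hh]
  choose a ha using fun i => exists_coeff hdet (coordVec e i y)
  have hG : (Matrix.of fun i j => g.inner (e.symm y) (F i (e.symm y)) (F j (e.symm y))) = P :=
    hg (e.symm y)
  have hH : (Matrix.of fun i j => h.inner (e.symm y) (F i (e.symm y)) (F j (e.symm y))) = 1 :=
    hh (e.symm y)
  have h1 := det_inner_sum g (fun i => F i (e.symm y)) (Matrix.of fun k i => a i k)
  have h2 := det_inner_sum h (fun i => F i (e.symm y)) (Matrix.of fun k i => a i k)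
  simp only [Matrix.of_apply, ← ha, hG, hH] at h1 h2
  rw [volDensity, volDensity, h1, h2, mul_comm, Real.sqrt_mul hP, Matrix.det_one, mul_one]

variable [MeasurableSpace M]

lemma riemVolume_eq_smul {g h : Metric M} {F : Fin 3 → VField M}
    {P : Matrix (Fin 3) (Fin 3) ℝ} (hg : ∀ x, gram g F x = P) (hh : ∀ x, gram h F x = 1)
    (hP : 0 < P.det) : riemVolume g = ENNReal.ofReal √P.det • riemVolume h := by
  set r := ENNReal.ofReal √P.det with hr
  have hr0 : r ≠ 0 := by
    rw [hr, Ne, ENNReal.ofReal_eq_zero, not_le]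
    exact Real.sqrt_pos.2 hP
  have hrt : r ≠ ⊤ := ENNReal.ofReal_ne_top
  have hchart : ∀ e : OpenPartialHomeomorph M E3, chartVolume g e = r • chartVolume h e := fun e => by
    have : (fun y => ENNReal.ofReal (volDensity g e y)) =
        r • fun y => ENNReal.ofReal (volDensity h e y) := by
      funext y
      rw [volDensity_eq_sqrt_mul hg hh hP.le, ENNReal.ofReal_mul (Real.sqrt_nonneg _)]
      rfl
    rw [chartVolume, this, withDensity_smul' _ _ hrt, Measure.map_smul, chartVolume]
  have hmono : ∀ (c : ENNReal) {μ ν : Measure M}, μ ≤ ν → c • μ ≤ c • ν := fun c μ ν hμν =>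
    Measure.le_iff'.2 fun s => by
      simp only [Measure.smul_apply]
      exact mul_le_mul_right (Measure.le_iff'.1 hμν s) c
  simp only [riemVolume, hchart]
  refine le_antisymm (iSup_le fun x => ?_) ?_
  · exact hmono r (le_iSup (fun x : M => chartVolume h (chartAt E3 x)) x)
  -- Multiplication by `r` commutes with the supremum because it is monotone with monotone inverse
  -- `r⁻¹`.
  · have h1 : (⨆ x : M, chartVolume h (chartAt E3 x)) ≤
        r⁻¹ • ⨆ x : M, r • chartVolume h (chartAt E3 x) := iSup_le fun x => by
      have := hmono r⁻¹ (le_iSup (fun x : M => r • chartVolume h (chartAt E3 x)) x)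
      simpa [smul_smul, ENNReal.inv_mul_cancel hr0 hrt] using this
    have h2 := hmono r h1
    simpa [smul_smul, ENNReal.mul_inv_cancel hr0 hrt] using h2

end Volume

/-! ### Chart independence and local finiteness of the volume measure. -/

section LocallyFinite

lemma measurableSet_target_inter_preimage {M : Type*} [TopologicalSpace M]
    [MeasurableSpace M] [BorelSpace M] (e : OpenPartialHomeomorph M E3) {s : Set M}
    (hs : MeasurableSet s) : MeasurableSet (e.target ∩ e.symm ⁻¹' s) := by
  have hm : Measurable (e.target.domRestrict e.symm) :=
    (continuousOn_iff_continuous_domRestrict.1 e.continuousOn_symm).measurable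
  have h := e.open_target.measurableSet.subtype_image (hm hs)
  convert! h using 1
  ext y
  simp [and_comm]

variable {M : Type*} [TopologicalSpace M] [ChartedSpace E3 M] [IsManifold (𝓡 3) ∞ M]

/-- The coordinate vector fields of two charts are related by the derivative of the transition. -/
lemma volDensity_eq_abs_det_mul (g : Metric M) {e e' : OpenPartialHomeomorph M E3}
    (he : e ∈ atlas E3 M) (he' : e' ∈ atlas E3 M) {y : E3} (hy : y ∈ e.target)
    (hy' : e.symm y ∈ e'.source) :
    DifferentiableAt ℝ (e' ∘ e.symm) y ∧ volDensity g e y =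
      |(fderiv ℝ (e' ∘ e.symm) y).det| * volDensity g e' (e' (e.symm y)) := by
  have hd1 : MDifferentiableAt (𝓡 3) (𝓡 3) e.symm y := mdifferentiableAt_atlas_symm he hy
  have hd2 : MDifferentiableAt (𝓡 3) (𝓡 3) e' (e.symm y) := mdifferentiableAt_atlas he' hy'
  have hd : MDifferentiableAt (𝓡 3) (𝓡 3) (e' ∘ e.symm) y := hd2.comp y hd1
  have hd' : DifferentiableAt ℝ (e' ∘ e.symm) y := mdifferentiableAt_iff_differentiableAt.1 hd
  refine ⟨hd', ?_⟩
  set φ := e' ∘ e.symm with hφ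
  have hd3 : MDifferentiableAt (𝓡 3) (𝓡 3) e'.symm (φ y) :=
    mdifferentiableAt_atlas_symm he' (e'.map_source hy')
  have heq : e.symm =ᶠ[𝓝 y] e'.symm ∘ φ := by
    have : ∀ᶠ z in 𝓝 y, e.symm z ∈ e'.source :=
      hd1.continuousAt.eventually (e'.open_source.mem_nhds hy')
    filter_upwards [this] with z hz
    simp [hφ, hz]
  have hderiv : ∀ v : E3, (mfderiv (𝓡 3) (𝓡 3) e.symm y v : E3) =
      mfderiv (𝓡 3) (𝓡 3) e'.symm (φ y) (fderiv ℝ φ y v) := fun v => by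
    have h1 : (mfderiv (𝓡 3) (𝓡 3) e.symm y : E3 →L[ℝ] E3) =
      mfderiv (𝓡 3) (𝓡 3) (e'.symm ∘ φ) y := heq.mfderiv_eq
    have h2 : (mfderiv (𝓡 3) (𝓡 3) (e'.symm ∘ φ) y : E3 →L[ℝ] E3) = _ := mfderiv_comp y hd3 hd
    rw [mfderiv_eq_fderiv] at h2
    exact (DFunLike.congr_fun h1 v).trans (DFunLike.congr_fun h2 v)
  set b := (EuclideanSpace.basisFun (Fin 3) ℝ).toBasis with hb
  set J := LinearMap.toMatrix b b (fderiv ℝ φ y : E3 →ₗ[ℝ] E3) with hJ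
  have hJdet : (fderiv ℝ φ y).det = J.det := (LinearMap.det_toMatrix b _).symm
  have hJsum : ∀ i, fderiv ℝ φ y (EuclideanSpace.single i 1) =
      ∑ k, J k i • (EuclideanSpace.single k 1 : E3) := fun i => by
    have := b.sum_repr (fderiv ℝ φ y (EuclideanSpace.single i 1))
    rw [← this]
    simp [hJ, LinearMap.toMatrix_apply, hb]
  have hcoord : ∀ i, (coordVec e i y : E3) = ∑ k, J k i • (coordVec e' k (φ y) : E3) := fun i => by
    have := hderiv (EuclideanSpace.single i 1)
    rw [hJsum] at this
    refine this.trans ?_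
    exact (map_sum (mfderiv (𝓡 3) (𝓡 3) e'.symm (φ y)) _ _).trans
      (Finset.sum_congr rfl fun k _ => map_smul _ _ _)
  have hpt : e.symm y = e'.symm (φ y) := heq.eq_of_nhds
  have hmat : (Matrix.of fun i j : Fin 3 =>
      g.inner (e.symm y) (coordVec e i y) (coordVec e j y)) = Matrix.of fun i j =>
      g.inner (e'.symm (φ y)) (∑ k, J k i • coordVec e' k (φ y)) (∑ l, J l j • coordVec e' l (φ y)) := by
    ext i j
    simp only [Matrix.of_apply]
    refine (inner_congr g hpt _ _).trans ?_
    rw [hcoord, hcoord]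
  rw [volDensity, hmat, det_inner_sum, Real.sqrt_mul (sq_nonneg _), Real.sqrt_sq_eq_abs, hJdet]
  rfl

lemma continuousAt_volDensity (g : Metric M) {e : OpenPartialHomeomorph M E3}
    (he : e ∈ atlas E3 M) {y : E3} (hy : y ∈ e.target) : ContinuousAt (volDensity g e) y := by
  have hsm : ContMDiffAt (𝓡 3) (𝓡 3) ∞ e.symm y :=
    contMDiffAt_symm_of_mem_maximalAtlas (IsManifold.subset_maximalAtlas he) hy
  have hsec : ∀ i, ContMDiffAt (𝓡 3) ((𝓡 3).prod (𝓡 3)) ∞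
      (fun z => TotalSpace.mk' E3 (E := TangentSpace (𝓡 3)) (e.symm z) (coordVec e i z)) y := fun i =>
    ContMDiffAt.clm_apply_of_inCoordinates (hsm.mfderiv_const (m := ∞) le_rfl)
      (contMDiffAt_vectorSpace_iff_contDiffAt.2 contDiffAt_const) hsm
  have hentry : ∀ i j, ContinuousAt
      (fun z => g.inner (e.symm z) (coordVec e i z) (coordVec e j z)) y := fun i j => by
    have h := ContMDiffAt.clm_bundle_apply₂ (F₁ := E3) (F₂ := E3) (F₃ := ℝ)
      (E₃ := Bundle.Trivial M ℝ) (g.contMDiff.contMDiffAt.comp y hsm) (hsec i) (hsec j)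
    exact (contMDiffAt_totalSpace.1 h).2.continuousAt
  change ContinuousAt (fun z => √(Matrix.det (Matrix.of fun i j : Fin 3 =>
    g.inner (e.symm z) (coordVec e i z) (coordVec e j z)))) y
  simp only [Matrix.det_fin_three, Matrix.of_apply]
  fun_prop

variable [MeasurableSpace M] [BorelSpace M]

lemma chartVolume_apply (g : Metric M) (e : OpenPartialHomeomorph M E3) {s : Set M}
    (hs : MeasurableSet s) : chartVolume g e s =
      ∫⁻ y in e.target ∩ e.symm ⁻¹' s, ENNReal.ofReal (volDensity g e y) := by
  have hae : AEMeasurable e.symm ((volume : Measure E3).restrict e.target) :=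
    e.continuousOn_symm.aemeasurable e.open_target.measurableSet
  rw [chartVolume, Measure.map_apply_of_aemeasurable
    (hae.mono_ac (withDensity_absolutelyContinuous _ _)) hs, withDensity_apply',
    Measure.restrict_restrict', Set.inter_comm]
  exact e.open_target.measurableSet

/-- Change of variables along the transition map, whose Jacobian relates the two densities. -/
lemma chartVolume_le_of_subset_source (g : Metric M) {e e' : OpenPartialHomeomorph M E3}
    (he : e ∈ atlas E3 M) (he' : e' ∈ atlas E3 M) {s : Set M} (hs : MeasurableSet s)
    (hs' : s ⊆ e'.source) : chartVolume g e s ≤ chartVolume g e' s := by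
  rw [chartVolume_apply g e hs, chartVolume_apply g e' hs]
  set T := e.target ∩ e.symm ⁻¹' s with hT
  have hTm : MeasurableSet T := measurableSet_target_inter_preimage e hs
  have hrel := fun y (hy : y ∈ T) => volDensity_eq_abs_det_mul g he he' hy.1 (hs' hy.2)
  have hinj : Set.InjOn (e' ∘ e.symm) T := fun y hy z hz hyz =>
    e.symm.injOn hy.1 hz.1 (e'.injOn (hs' hy.2) (hs' hz.2) hyz)
  have himage : (e' ∘ e.symm) '' T ⊆ e'.target ∩ e'.symm ⁻¹' s := by
    rintro _ ⟨y, hy, rfl⟩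
    refine ⟨e'.map_source (hs' hy.2), ?_⟩
    simpa [e'.left_inv (hs' hy.2)] using hy.2
  calc ∫⁻ y in T, ENNReal.ofReal (volDensity g e y)
      = ∫⁻ y in T, ENNReal.ofReal |(fderiv ℝ (e' ∘ e.symm) y).det| *
          ENNReal.ofReal (volDensity g e' ((e' ∘ e.symm) y)) :=
        setLIntegral_congr_fun hTm fun y hy => by
          rw [(hrel y hy).2, ENNReal.ofReal_mul (abs_nonneg _)]
          rfl
    _ = ∫⁻ z in (e' ∘ e.symm) '' T, ENNReal.ofReal (volDensity g e' z) :=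
        (lintegral_image_eq_lintegral_abs_det_fderiv_mul volume hTm
          (fun y hy => (hrel y hy).1.hasFDerivAt.hasFDerivWithinAt) hinj
          fun z => ENNReal.ofReal (volDensity g e' z)).symm
    _ ≤ _ := lintegral_mono_set himage

lemma riemVolume_restrict_source_le (g : Metric M) {e : OpenPartialHomeomorph M E3}
    (he : e ∈ atlas E3 M) {s : Set M} (hs : MeasurableSet s) (hse : s ⊆ e.source) :
    riemVolume g s ≤ chartVolume g e s := by
  have hm : MeasurableSet e.source := e.open_source.measurableSet
  -- A supremum is bounded by any common upper bound; this one agrees with the chart measure inside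
  -- the chart domain.
  have hle : riemVolume g ≤
      (chartVolume g e).restrict e.source + (riemVolume g).restrict e.sourceᶜ := by
    refine iSup_le fun x => Measure.le_iff.2 fun t ht => ?_
    rw [← measure_inter_add_sdiff t hm, Measure.add_apply, Measure.restrict_apply ht,
      Measure.restrict_apply ht]
    refine add_le_add ?_ ?_
    · exact chartVolume_le_of_subset_source g (chart_mem_atlas E3 x) he (ht.inter hm)
        Set.inter_subset_right
    · exact Measure.le_iff'.1 (le_iSup (fun x : M => chartVolume g (chartAt E3 x)) x) _
  have h := Measure.le_iff'.1 hle s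
  rwa [Measure.add_apply, Measure.restrict_apply hs, Measure.restrict_apply hs,
    Set.inter_eq_left.2 hse, (Set.disjoint_compl_right_iff_subset.2 hse).inter_eq, measure_empty,
    add_zero] at h

/-- Gives compact sets finite volume: near each point the density is bounded by continuity. -/
instance isLocallyFiniteMeasure_riemVolume (g : Metric M) :
    IsLocallyFiniteMeasure (riemVolume g) := by
  refine ⟨fun x => ?_⟩
  set e := chartAt E3 x with he
  have hx : x ∈ e.source := mem_chart_source E3 x
  have hc := continuousAt_volDensity g (chart_mem_atlas E3 x) (e.map_source hx)
  have hev : ∀ᶠ y in 𝓝 (e x), volDensity g e y < volDensity g e (e x) + 1 :=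
    hc.eventually (gt_mem_nhds (lt_add_one _))
  obtain ⟨r, hr, hball⟩ := Metric.eventually_nhds_iff_ball.1 hev
  have hU : IsOpen (e.source ∩ e ⁻¹' Metric.ball (e x) r) :=
    e.isOpen_inter_preimage Metric.isOpen_ball
  refine ⟨_, hU.mem_nhds ⟨hx, Metric.mem_ball_self hr⟩, ?_⟩
  refine (riemVolume_restrict_source_le g (chart_mem_atlas E3 x) hU.measurableSet
    Set.inter_subset_left).trans_lt ?_
  rw [chartVolume_apply g _ hU.measurableSet]
  have hsub : e.target ∩ e.symm ⁻¹' (e.source ∩ e ⁻¹' Metric.ball (e x) r) ⊆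
      Metric.ball (e x) r := fun y hy => by
    have := hy.2.2
    rwa [Set.mem_preimage, e.right_inv hy.1] at this
  calc _ ≤ ∫⁻ y in Metric.ball (e x) r, ENNReal.ofReal (volDensity g e y) :=
        lintegral_mono_set hsub
    _ ≤ ∫⁻ _ in Metric.ball (e x) r, ENNReal.ofReal (volDensity g e (e x) + 1) :=
        setLIntegral_mono measurable_const fun y hy =>
          ENNReal.ofReal_le_ofReal (hball y hy).le
    _ < ⊤ := by
        rw [setLIntegral_const]
        exact ENNReal.mul_lt_top ENNReal.ofReal_lt_top measure_ball_lt_top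

end LocallyFinite

/-! ### The Ricci flow -/

section Flow

lemma strictAntiOn_div_and_tendsto {A B : ℝ → ℝ}
    (h : ∀ t, 0 ≤ t → 0 < A t ∧ 0 < B t ∧ HasDerivAt A (-2 * (2 * A t ^ 2 / B t ^ 2)) t ∧
      HasDerivAt B (-2 * (-4 - 2 * A t / B t)) t) :
    StrictAntiOn (fun t => A t / B t) (Set.Ici 0) ∧
      Filter.Tendsto (fun t => A t / B t) Filter.atTop (𝓝 0) := by
  have hAcont : ContinuousOn A (Set.Ici 0) := fun t ht =>
    (h t ht).2.2.1.continuousAt.continuousWithinAt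
  have hBcont : ContinuousOn B (Set.Ici 0) := fun t ht =>
    (h t ht).2.2.2.continuousAt.continuousWithinAt
  have hAanti : StrictAntiOn A (Set.Ici 0) :=
    strictAntiOn_of_deriv_neg (convex_Ici 0) hAcont fun t ht => by
      rw [interior_Ici] at ht
      obtain ⟨hA, hB, hdA, -⟩ := h t (le_of_lt ht)
      rw [hdA.deriv]
      have : 0 < 2 * A t ^ 2 / B t ^ 2 := by positivity
      linarith
  -- `B' - 8 = 4A/B ≥ 0`, hence `B ≥ B 0 + 8t`; this gives both the monotonicity and the decay of
  -- the quotient.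
  have hBmono : MonotoneOn (fun t => B t - 8 * t) (Set.Ici 0) := by
    have hd : ∀ t, 0 ≤ t → HasDerivAt (fun t => B t - 8 * t) (4 * A t / B t) t := fun t ht => by
      refine ((h t ht).2.2.2.sub ((hasDerivAt_id t).const_mul 8)).congr_deriv ?_
      ring
    refine monotoneOn_of_deriv_nonneg (convex_Ici 0)
      (fun t ht => (hd t ht).continuousAt.continuousWithinAt) (fun t ht => ?_) fun t ht => ?_
    all_goals rw [interior_Ici] at ht
    · exact (hd t (le_of_lt ht)).differentiableAt.differentiableWithinAt
    · obtain ⟨hA, hB, -⟩ := h t (le_of_lt ht)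
      rw [(hd t (le_of_lt ht)).deriv]
      positivity
  refine ⟨fun s hs t ht hst => ?_, ?_⟩
  · have hB := hBmono hs ht hst.le
    exact div_lt_div₀ (hAanti hs ht hst) (by simp only at hB; linarith) (h s hs).1.le (h s hs).2.1
  · have hlin : Filter.Tendsto (fun t : ℝ => A 0 / (8 * t)) Filter.atTop (𝓝 0) :=
      Filter.Tendsto.div_atTop tendsto_const_nhds
        (Filter.tendsto_id.const_mul_atTop (by norm_num : (0 : ℝ) < 8))
    refine squeeze_zero' ?_ ?_ hlin
    · filter_upwards [Filter.eventually_ge_atTop 0] with t ht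
      exact (div_pos (h t ht).1 (h t ht).2.1).le
    · filter_upwards [Filter.eventually_gt_atTop 0] with t ht
      have hB := hBmono (Set.mem_Ici.2 le_rfl) (Set.mem_Ici.2 ht.le) ht.le
      have hB0 := (h 0 le_rfl).2.1
      have hA := hAanti.antitoneOn (Set.mem_Ici.2 le_rfl) (Set.mem_Ici.2 ht.le) ht.le
      exact div_le_div₀ (h 0 le_rfl).1.le hA (by positivity) (by simp only at hB; linarith)

variable {G : Type*} [TopologicalSpace G] [ChartedSpace E3 G] [Group G] [LieGroup (𝓡 3) ∞ G]
  {e : Module.Basis (Fin 3) ℝ (GroupLieAlgebra (𝓡 3) G)}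

lemma hasDerivWithinAt_diagonal {A B : ℝ → ℝ} {a b t : ℝ} {s : Set ℝ}
    (hA : HasDerivWithinAt A (-2 * a) s t) (hB : HasDerivWithinAt B (-2 * b) s t) (i j : Fin 3) :
    HasDerivWithinAt (fun u => Matrix.diagonal ![A u, B u, B u] i j)
      (-2 * Matrix.diagonal ![a, b, b] i j) s t := by
  fin_cases i <;> fin_cases j <;> simp <;>
    first
    | simpa using hA
    | simpa using hB
    | exact hasDerivWithinAt_const _ _ _

/-- Left-invariant metrics `diag(A, B, B)` solve the Ricci flow if `A` and `B` solve the reduced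
system. -/
lemma exists_isLeftInvariantRicciFlow (he : MilnorRelations e (-1) 1 1) {g₀ : Metric G}
    {A B : ℝ → ℝ} (hg₀ : IsLeftInvariantDiagonal g₀ e (A 0) (B 0) (B 0))
    (h : ∀ t, 0 ≤ t → 0 < A t ∧ 0 < B t ∧ HasDerivAt A (-2 * (2 * A t ^ 2 / B t ^ 2)) t ∧
      HasDerivAt B (-2 * (-4 - 2 * A t / B t)) t) :
    ∃ g : ℝ → Metric G, IsLeftInvariantRicciFlow g e ∧ g 0 = g₀ := by
  -- At `t = 0` the choice must be `g₀` itself; at negative times anything serves.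
  have hex : ∀ t, ∃ g : Metric G, (0 ≤ t → IsLeftInvariantDiagonal g e (A t) (B t) (B t)) ∧
      (t = 0 → g = g₀) := fun t => by
    rcases eq_or_ne t 0 with rfl | ht
    · exact ⟨g₀, fun _ => hg₀, fun _ => rfl⟩
    · by_cases ht0 : 0 ≤ t
      · obtain ⟨g, hg⟩ := exists_isLeftInvariantDiagonal (h 0 le_rfl).1 (h 0 le_rfl).2.1 hg₀
          (h t ht0).1 (h t ht0).2.1
        exact ⟨g, fun _ => hg, fun h0 => (ht h0).elim⟩
      · exact ⟨g₀, fun h0 => (ht0 h0).elim, fun h0 => (ht h0).elim⟩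
  choose g hg hg0 using hex
  refine ⟨g, ⟨fun t ht => (hg t ht).1, fun t ht x i j => ?_⟩, hg0 0 rfl⟩
  obtain ⟨hA, hB, hdA, hdB⟩ := h t ht
  have hdet : (Matrix.diagonal ![A t, B t, B t]).det ≠ 0 := by
    rw [det_diagonal_three]; positivity
  rw [ricci_eq (hg t ht).2 hdet (bracket_frame he), ricciAlg_diagonal hA.ne' hB.ne']
  refine (hasDerivWithinAt_diagonal hdA.hasDerivWithinAt hdB.hasDerivWithinAt i j).congr
    (fun s hs => ?_) ?_
  · rw [(hg s hs).2]
  · rw [(hg t ht).2]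

/-- The Ricci flow through left-invariant metrics that starts at `diag(A, B, B)` keeps this form. -/
lemma isLeftInvariantDiagonal_of_ricciFlow (he : MilnorRelations e (-1) 1 1) {g : ℝ → Metric G}
    (hg : IsLeftInvariantRicciFlow g e) {A B : ℝ → ℝ}
    (hg0 : IsLeftInvariantDiagonal (g 0) e (A 0) (B 0) (B 0))
    (h : ∀ t, 0 ≤ t → 0 < A t ∧ 0 < B t ∧ HasDerivAt A (-2 * (2 * A t ^ 2 / B t ^ 2)) t ∧
      HasDerivAt B (-2 * (-4 - 2 * A t / B t)) t) {t : ℝ} (ht : 0 ≤ t) :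
    IsLeftInvariantDiagonal (g t) e (A t) (B t) (B t) := by
  have hdiag : ∀ s, 0 ≤ s → (Matrix.diagonal ![A s, B s, B s]).det ≠ 0 := fun s hs => by
    obtain ⟨hA, hB, -⟩ := h s hs
    rw [det_diagonal_three]; positivity
  have hli : LinearIndependent ℝ (fun i => frame e i 1) :=
    linearIndependent_of_det_gram_ne_zero (g := g 0) (by rw [hg0.2]; exact hdiag 0 le_rfl)
  have hdet : ∀ s, (gram (g s) (frame e) 1).det ≠ 0 := fun s =>
    det_gram_ne_zero_of_linearIndependent (g s) hli
  -- The unknown is the full Gram matrix at `1`, so off-diagonal entries and `B ≠ C` are excluded by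
  -- uniqueness.
  have huniq := eq_of_hasDerivWithinAt_Ici (f := ricciVectorField milnorConst)
    (U := {p | (Matrix.of p).det ≠ 0}) (y := fun s i j => gram (g s) (frame e) 1 i j)
    (z := fun s i j => Matrix.diagonal ![A s, B s, B s] i j)
    (fun p hp => contDiffAt_ricciVectorField _ hp)
    (fun s hs => hasDerivWithinAt_pi.2 fun i => hasDerivWithinAt_pi.2 fun j => by
      have := hg.ricciFlow s hs 1 i j
      rwa [ricci_eq (gram_eq_gram_one (hg.leftInvariant s hs) e) (hdet s) (bracket_frame he)]
        at this)
    (fun s hs => hasDerivWithinAt_pi.2 fun i => hasDerivWithinAt_pi.2 fun j => by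
      obtain ⟨hA, hB, hdA, hdB⟩ := h s hs
      have := hasDerivWithinAt_diagonal hdA.hasDerivWithinAt hdB.hasDerivWithinAt (s := Set.Ici 0) i j
      rwa [← ricciAlg_diagonal hA.ne' hB.ne'] at this)
    (fun s _ => hdet s) hdiag (by simp only [hg0.2]) ht
  refine ⟨hg.leftInvariant t ht, fun x => ?_⟩
  rw [gram_eq_gram_one (hg.leftInvariant t ht)]
  ext i j
  exact congrFun (congrFun huniq i) j

lemma cottonYorkL1_eq [MeasurableSpace G] (he : MilnorRelations e (-1) 1 1) {g h : Metric G}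
    {A B : ℝ} (hA : 0 < A) (hB : 0 < B) (hg : IsLeftInvariantDiagonal g e A B B)
    (hh : IsLeftInvariantDiagonal h e 1 1 1) (K : Set G) :
    cottonYorkL1 g (frame e) K =
      4 * √6 * (A / B) * (1 + A / B) * (riemVolume h).real K := by
  have hh1 : ∀ x, gram h (frame e) x = 1 := fun x => by
    rw [hh.2, ← Matrix.diagonal_one]
    congr 1
    funext i
    fin_cases i <;> rfl
  have hs : 0 < √(A * B * B) := by positivity
  have hnorm : cottonYorkNorm g (frame e) =
      fun _ => 4 * √6 * (A / B) * (1 + A / B) / √(A * B * B) := funext fun x => by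
    rw [eq_div_iff hs.ne']
    exact cottonYorkNorm_diagonal hA hB hg.2 (bracket_frame he) x
  have hvol := riemVolume_eq_smul hg.2 hh1 (by rw [det_diagonal_three]; positivity)
  rw [cottonYorkL1, hnorm, setIntegral_const, hvol, measureReal_ennreal_smul_apply,
    ENNReal.toReal_ofReal (Real.sqrt_nonneg _), det_diagonal_three, smul_eq_mul]
  field_simp

end Flow

end CottonYork
end

theorem theorem3p6
    {G : Type*} [TopologicalSpace G] [ChartedSpace CottonYork.E3 G] [Group G]
    [LieGroup (𝓡 3) ∞ G] [T2Space G] [SecondCountableTopology G]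
    [MeasurableSpace G] [BorelSpace G]
    -- `G` is the universal covering group of `SL(2, ℝ)`
    (p : G →* Matrix.SpecialLinearGroup (Fin 2) ℝ) (hp : CottonYork.IsUniversalCoverSL2 p)
    -- a Milnor frame with `λ = -1`, `μ = ν = 1`
    (e : Module.Basis (Fin 3) ℝ (GroupLieAlgebra (𝓡 3) G))
    (he : CottonYork.MilnorRelations e (-1) 1 1)
    -- the initial metric
    (g₀ : CottonYork.Metric G) (A₀ B₀ C₀ : ℝ) (hA : 0 < A₀) (hB : 0 < B₀) (hBC : B₀ = C₀)
    (hg₀ : CottonYork.IsLeftInvariantDiagonal g₀ e A₀ B₀ C₀) :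
    -- the Ricci flow starting at `g₀` exists for all positive time
    (∃ g : ℝ → CottonYork.Metric G, CottonYork.IsLeftInvariantRicciFlow g e ∧ g 0 = g₀) ∧
    -- `h = ω^1 ⊗ ω^1 + ω^2 ⊗ ω^2 + ω^3 ⊗ ω^3`
    ∃ h : CottonYork.Metric G, CottonYork.IsLeftInvariantDiagonal h e 1 1 1 ∧
      ∀ g : ℝ → CottonYork.Metric G, CottonYork.IsLeftInvariantRicciFlow g e → g 0 = g₀ →
        -- `g(t) = A(t) ω^1 ⊗ ω^1 + B(t) (ω^2 ⊗ ω^2 + ω^3 ⊗ ω^3)`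
        ∃ A B : ℝ → ℝ,
          (∀ t, 0 ≤ t → 0 < A t ∧ 0 < B t ∧
            CottonYork.IsLeftInvariantDiagonal (g t) e (A t) (B t) (B t)) ∧
          ∀ K : Set G, IsCompact K →
            (∀ t, 0 ≤ t → CottonYork.cottonYorkL1 (g t) (CottonYork.frame e) K =
              4 * √6 * (A t / B t) * (1 + A t / B t) * (CottonYork.riemVolume h).real K) ∧
            (0 < CottonYork.riemVolume h K →
              StrictAntiOn (fun t => CottonYork.cottonYorkL1 (g t) (CottonYork.frame e) K)
                (Set.Ici 0)) ∧
            Filter.Tendsto (fun t => CottonYork.cottonYorkL1 (g t) (CottonYork.frame e) K)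
              Filter.atTop (𝓝 0) := by
  subst hBC
  obtain ⟨A, B, rfl, rfl, hAB⟩ := CottonYork.exists_solution hA hB
  refine ⟨CottonYork.exists_isLeftInvariantRicciFlow he hg₀ hAB, ?_⟩
  obtain ⟨h, hh⟩ := CottonYork.exists_isLeftInvariantDiagonal hA hB hg₀ one_pos one_pos
  refine ⟨h, hh, fun g hg hg0 => ⟨A, B, ?_⟩⟩
  have hdiag : ∀ t, 0 ≤ t → CottonYork.IsLeftInvariantDiagonal (g t) e (A t) (B t) (B t) :=
    fun t ht => CottonYork.isLeftInvariantDiagonal_of_ricciFlow he hg (hg0.symm ▸ hg₀) hAB ht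
  refine ⟨fun t ht => ⟨(hAB t ht).1, (hAB t ht).2.1, hdiag t ht⟩, fun K hK => ?_⟩
  have hL1 : ∀ t, 0 ≤ t → CottonYork.cottonYorkL1 (g t) (CottonYork.frame e) K =
      4 * √6 * (A t / B t) * (1 + A t / B t) * (CottonYork.riemVolume h).real K := fun t ht =>
    CottonYork.cottonYorkL1_eq he (hAB t ht).1 (hAB t ht).2.1 (hdiag t ht) hh K
  obtain ⟨hanti, hlim⟩ := CottonYork.strictAntiOn_div_and_tendsto hAB
  refine ⟨hL1, fun hpos s hs t ht hst => ?_, ?_⟩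
  -- Finiteness matters: `Measure.real` is `0` on sets of infinite measure.
  · have hvol : 0 < (CottonYork.riemVolume h).real K :=
      ENNReal.toReal_pos hpos.ne' hK.measure_lt_top.ne
    have hr := hanti hs ht hst
    have hrt : 0 < A t / B t := div_pos (hAB t ht).1 (hAB t ht).2.1
    have h6 : 0 < 4 * √6 := by positivity
    simp only at hr ⊢
    rw [hL1 s hs, hL1 t ht]
    gcongr
  · have hlim' := (((hlim.const_mul (4 * √6)).mul (hlim.const_add 1)).mul_const
      ((CottonYork.riemVolume h).real K))
    simp only [mul_zero, zero_mul] at hlim'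
    refine hlim'.congr' ?_
    filter_upwards [Filter.eventually_ge_atTop 0] with t ht
    exact (hL1 t ht).symm
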